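/- **Notation.** Let $d$ be a nonnegative integer and $\mathcal F_d$ the free semigroup of words in the letters $1,\dots,d$, with unit $\emptyset$, with concatenation as product, and with $v^\top$ the word $v$ reversed. For operators $\mathbf T=(T_1,\dots,T_d)$ on a Hilbert space put $\mathbf T^{v}=T_{i_N}\cdots T_{i_1}$ if $v=i_N\cdots i_1$, and $\mathbf T^\emptyset=I$. For a complex Hilbert space $\mathcal Y$ let $$H^2_{\mathcal Y}(\mathcal F_d)=\Big\{f(z)=\sum_{v\in\mathcal F_d}f_vz^v:\ f_v\in\mathcal Y,\ \sum_v\|f_v\|^2<\infty\Big\}$$ (noncommuting indeterminates $z=(z_1,\dots,z_d)$), with shifts $S_jf(z)=f(z)\cdot z_j$. For a formal power series $S(z)=\sum_v s_vz^v$ with $s_v\in\mathcal L(\mathcal U,\mathcal Y)$, the product $S(z)\cdot f(z)$ has coefficients $\sum_{\alpha\beta=v}s_\alpha f_\beta$; $S$ is in the Schur class $\mathcal S_{nc,d}(\mathcal U,\mathcal Y)$ if $M_S\colon f\mapsto S\cdot f$ is a contraction from $H^2_{\mathcal U}(\mathcal F_d)$ to $H^2_{\mathcal Y}(\mathcal F_d)$,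 and such an $S$ is *inner* if $M_S$ is isometric. Let $\mathcal X,\mathcal Y$ be complex Hilbert spaces, $\mathbf Z=(Z_1,\dots,Z_d)$ with $Z_j\in\mathcal L(\mathcal X)$, and $X\in\mathcal L(\mathcal Y,\mathcal X)$. The pair $(\mathbf Z,X)$ is an *admissible homogeneous interpolation data set* if it is an isometric input pair, $I_{\mathcal X}-\sum_jZ_jZ_j^*=XX^*$, and $\mathbf Z^*=(Z_1^*,\dots,Z_d^*)$ is strongly stable: $\lim_{N\to\infty}\sum_{|v|=N}\|(\mathbf Z^*)^vx\|^2=0$ for all $x\in\mathcal X$. Put $$\mathcal C_{\mathbf Z,X}f=\sum_{v\in\mathcal F_d}\mathbf Z^{v^\top}Xf_v,\qquad \mathcal M_{\mathbf Z,X}=\{f\in H^2_{\mathcal Y}(\mathcal F_d):\ \mathcal C_{\mathbf Z,X}f=0\}.$$ **Theorem.** Let $(\mathbf Z,X)$ be an admissible homogeneous interpolation data set. Then the series $\mathcal C_{\mathbf Z,X}f$ converges for every $f\in H^2_{\mathcal Y}(\mathcal F_d)$ and defines a bounded operator $\mathcal C_{\mathbf Z,X}\colon H^2_{\mathcal Y}(\mathcal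 F_d)\to\mathcal X$, and $\mathcal M_{\mathbf Z,X}=\operatorname{Ker}\mathcal C_{\mathbf Z,X}$ is invariant under $S_1,\dots,S_d$. Let $(C,\mathbf A)=(X^*,\mathbf Z^*)$, and let $A\colon\mathcal X\to\mathcal X^d$ be the column with entries $A_j=Z_j^*$. Consider a Hilbert space $\mathcal U$ and an operator $\begin{bmatrix}B\\D\end{bmatrix}\colon\mathcal U\to\mathcal X^d\oplus\mathcal Y$ with $$\dim\mathcal U=\operatorname{rank}\Big(I-\begin{bmatrix}A\\C\end{bmatrix}\begin{bmatrix}A^*&C^*\end{bmatrix}\Big),\qquad \begin{bmatrix}B\\D\end{bmatrix}\begin{bmatrix}B^*&D^*\end{bmatrix}=I_{\mathcal X^d\oplus\mathcal Y}-\begin{bmatrix}A\\C\end{bmatrix}\begin{bmatrix}A^*&C^*\end{bmatrix},$$ where $\dim$ is the Hilbert space dimension and the rank is that of the closure of the range. Such $\mathcal U$, $B$, $D$ exist, and $\begin{bmatrix}B\\D\end{bmatrix}$ can be chosen injective. For every such choice, $\mathbf U=\begin{bmatrix}A&B\\C&D\end{bmatrix}\colon\mathcal X\oplus\mathcal U\to\mathcal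 X^d\oplus\mathcal Y$ is coisometric, and its transfer function $$\theta(z)=D+C(I-Z(z)A)^{-1}Z(z)B=D+\sum_{j=1}^d\sum_{v\in\mathcal F_d}C\mathbf A^vB_j\,z^vz_j,\qquad Z(z)=\begin{bmatrix}z_1I_{\mathcal X}&\cdots&z_dI_{\mathcal X}\end{bmatrix},$$ is in $\mathcal S_{nc,d}(\mathcal U,\mathcal Y)$ and satisfies $$\mathcal M_{\mathbf Z,X}=\theta\cdot H^2_{\mathcal U}(\mathcal F_d).$$ Moreover $\theta$ is inner, provided, in case $\mathcal U$ is infinite-dimensional, that $\begin{bmatrix}B\\D\end{bmatrix}$ is injective. -/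

import Mathlib

open Filter Topology ContinuousLinearMap

universe u v w

noncomputable section

namespace FockBL

/-- Words in the letters `1, …, d`, i.e. the free semigroup `𝓕_d`; the word `i_N ⋯ i_1` is the list
`[i_N, …, i_1]`, the product is concatenation `++`, the empty word is `[]` and the transpose is
`List.reverse`. -/
abbrev Word (d : ℕ) : Type := List (Fin d)

/-- The Fock space `H²_F(𝓕_d)`: formal power series `∑ f_v z^v` with coefficients in `F` such that
`∑ ‖f_v‖² < ∞`, identified with their coefficient families. -/
abbrev Fock (d : ℕ) (F : Type*) [NormedAddCommGroup F] : Type _ :=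
  lp (fun _ : Word d => F) 2

section Power

variable {d : ℕ} {E : Type*} [NormedAddCommGroup E] [InnerProductSpace ℂ E]

/-- `𝐀^v = A_{i_N} ⋯ A_{i_1}` for `v = i_N ⋯ i_1`, and `𝐀^∅ = I`. -/
def wpow (A : Fin d → E →L[ℂ] E) (v : Word d) : E →L[ℂ] E := (v.map A).prod

/-- Strong stability: `∑_{|v| = N} ‖𝐀^v x‖² → 0` as `N → ∞`, for every `x`. -/
def StronglyStable (A : Fin d → E →L[ℂ] E) : Prop :=
  ∀ x : E, Tendsto (fun N : ℕ => ∑ i : Fin N → Fin d, ‖wpow A (List.ofFn i) x‖ ^ 2) atTop (𝓝 0)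

end Power

section Multipliers

variable {d : ℕ} {V F : Type*} [NormedAddCommGroup V] [InnerProductSpace ℂ V]
  [NormedAddCommGroup F] [InnerProductSpace ℂ F]

/-- The coefficient of `z^v` in the product `S(z) · f(z)`: the sum of `s_α f_β` over all the
factorizations `v = α β`, which are `α = v.take k`, `β = v.drop k` for `k = 0, …, |v|`. -/
def mulCoeff (S : Word d → V →L[ℂ] F) (f : Word d → V) (v : Word d) : F :=
  ∑ k ∈ Finset.range (v.length + 1), S (v.take k) (f (v.drop k))

/-- `M` is the multiplication operator `M_S : f(z) ↦ S(z) · f(z)` between the Fock spaces. -/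
def IsMulOp (S : Word d → V →L[ℂ] F) (M : Fock d V →L[ℂ] Fock d F) : Prop :=
  ∀ (f : Fock d V) (v : Word d), M f v = mulCoeff S f v

/-- The noncommutative Schur class: `M_S` is a contraction from `H²_V` to `H²_F`. -/
def IsSchur (S : Word d → V →L[ℂ] F) : Prop :=
  ∃ M : Fock d V →L[ℂ] Fock d F, IsMulOp S M ∧ ‖M‖ ≤ 1

/-- `S` in the Schur class is inner if `M_S` is isometric. -/
def IsInner (S : Word d → V →L[ℂ] F) : Prop :=
  ∃ M : Fock d V →L[ℂ] Fock d F, IsMulOp S M ∧ ‖M‖ ≤ 1 ∧ Isometry M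

/-- `S · H²_V(𝓕_d)`, as a subset of `H²_F(𝓕_d)`. -/
def mulRange (S : Word d → V →L[ℂ] F) : Set (Fock d F) :=
  {g | ∃ f : Fock d V, ∀ v, g v = mulCoeff S f v}

/-- The coefficients of `f(z) · z_j`: the coefficient of `z^{v j}` is `f_v`, and the coefficients
of the words that do not end in `j` vanish. -/
def shiftCoeff (j : Fin d) (f : Word d → F) (v : Word d) : F :=
  if v.getLast? = some j then f v.dropLast else 0

end Multipliers

section Column

variable {d : ℕ} {E V F : Type*} [NormedAddCommGroup E] [InnerProductSpace ℂ E]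
  [NormedAddCommGroup V] [InnerProductSpace ℂ V] [NormedAddCommGroup F] [InnerProductSpace ℂ F]

/-- The Hilbert space direct sum `E^d ⊕ F`. -/
abbrev OutSpace (d : ℕ) (E F : Type*) : Type _ := WithLp 2 (PiLp 2 (fun _ : Fin d => E) × F)

/-- The column `[B_1; …; B_d; D] : V → E^d ⊕ F`. -/
def col (B : Fin d → V →L[ℂ] E) (D : V →L[ℂ] F) : V →L[ℂ] OutSpace d E F :=
  (WithLp.prodContinuousLinearEquiv 2 ℂ (PiLp 2 (fun _ : Fin d => E)) F).symm.toContinuousLinearMap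
    ∘L (((PiLp.continuousLinearEquiv 2 ℂ (fun _ : Fin d => E)).symm.toContinuousLinearMap
      ∘L ContinuousLinearMap.pi B).prod D)

/-- The colligation `𝐔 = [A B; C D] : E ⊕ V → E^d ⊕ F`. -/
def colligation (A : Fin d → E →L[ℂ] E) (B : Fin d → V →L[ℂ] E) (C : E →L[ℂ] F) (D : V →L[ℂ] F) :
    WithLp 2 (E × V) →L[ℂ] OutSpace d E F :=
  ((col A C).coprod (col B D))
    ∘L (WithLp.prodContinuousLinearEquiv 2 ℂ E V).toContinuousLinearMap

/-- The transfer function `D + C (I - Z(z) A)⁻¹ Z(z) B = D + ∑_j ∑_v C 𝐀^v B_j z^v z_j`, as a formal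
power series: the coefficient of `1` is `D` and that of `z^v z_j` is `C 𝐀^v B_j`. -/
def transfer (A : Fin d → E →L[ℂ] E) (B : Fin d → V →L[ℂ] E) (C : E →L[ℂ] F) (D : V →L[ℂ] F)
    (v : Word d) : V →L[ℂ] F :=
  if h : v = [] then D else C ∘L wpow A v.dropLast ∘L B (v.getLast h)

/-- The defect `I - [A; C] [A* C*]` on `E^d ⊕ F`. -/
def defect [CompleteSpace E] [CompleteSpace F] (A : Fin d → E →L[ℂ] E) (C : E →L[ℂ] F) :
    OutSpace d E F →L[ℂ] OutSpace d E F :=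
  1 - col A C ∘L adjoint (col A C)

/-- `[B; D] [B* D*] = I - [A; C] [A* C*]`. -/
def IsCholesky [CompleteSpace E] [CompleteSpace F] [CompleteSpace V]
    (A : Fin d → E →L[ℂ] E) (C : E →L[ℂ] F) (B : Fin d → V →L[ℂ] E) (D : V →L[ℂ] F) : Prop :=
  col B D ∘L adjoint (col B D) = defect A C

end Column

/-- `dim V = rank T`: the Hilbert space dimension of `V` (the cardinality of its orthonormal bases)
is that of the closure of the range of `T`. -/
def DimEqRank (V : Type w) [NormedAddCommGroup V] [InnerProductSpace ℂ V]
    {G : Type*} [NormedAddCommGroup G] [InnerProductSpace ℂ G] (T : G →L[ℂ] G) : Prop :=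
  ∃ ι : Type w, Nonempty (HilbertBasis ι ℂ V) ∧
    Nonempty (HilbertBasis ι ℂ (LinearMap.range T.toLinearMap).topologicalClosure)

section InputPair

variable {d : ℕ} {E F : Type*} [NormedAddCommGroup E] [InnerProductSpace ℂ E]
  [NormedAddCommGroup F] [InnerProductSpace ℂ F]

/-- An admissible homogeneous interpolation data set: `(𝐙, X)` is an isometric input pair,
`I - ∑ Z_j Z_j* = X X*`, and `𝐙*` is strongly stable. -/
structure IsAdmissible [CompleteSpace E] [CompleteSpace F]
    (Z : Fin d → E →L[ℂ] E) (X : F →L[ℂ] E) : Prop where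
  isometric : 1 - ∑ j, Z j ∘L adjoint (Z j) = X ∘L adjoint X
  stable : StronglyStable (fun j => adjoint (Z j))

/-- The terms `𝐙^{v⊤} X f_v` of the series `𝒞_{𝐙,X} f = (X f)^{∧L}(𝐙) = ∑_v 𝐙^{v⊤} X f_v`. -/
def ctrlTerm (Z : Fin d → E →L[ℂ] E) (X : F →L[ℂ] E) (f : Fock d F) (v : Word d) : E :=
  wpow Z v.reverse (X (f v))

/-- `𝓜_{𝐙,X}`: all `f ∈ H²_F(𝓕_d)` with `(X f)^{∧L}(𝐙) = 0`. -/
def interpSpace (Z : Fin d → E →L[ℂ] E) (X : F →L[ℂ] E) : Set (Fock d F) :=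
  {f | HasSum (ctrlTerm Z X f) 0}

end InputPair

end FockBL

end

/-! Multiplication by `θ` is the input-output map of the system `x_{jv} = A_j x_v + B_j f_v`, `g_v =
C x_v + D f_v`, `x_∅ = 0`. Isometry of the input pair makes `[A; C]` isometric, and the Cholesky
equation then puts the range of `[B; D]` in its orthogonal complement, so each step conserves
energy: input plus old state equals output plus new states. Summing over word lengths gives
contractivity (`isSchur_transfer`). If `[B; D]` is isometric, strong stability kills the final state
energy of finitely supported inputs, and density gives innerness (`isInner_transfer`).

The operator `𝒞_{𝐙,X}` is the adjoint of the observability operator `x ↦ (C 𝐀^v x)_v`, a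
contraction. On an output `g` its partial sums telescope to minus a sum of `𝐙^{v⊤} x_v` over the
words of one length, which tends weakly to `0`; hence `𝒞 g = 0` (`mem_interpSpace_of_eq_output`).
Conversely, for `g` in the kernel set `x_v = 𝒞(g_{·v})`. Applying `𝐔*` to the pair of `(x_{jv})_j`
and `g_v` returns `x_v` and an input `f_v`; since `𝐔𝐔* = I`, these satisfy the system equations, and
`x_∅ = 𝒞 g = 0` is the right initial state (`exists_input_of_mem_interpSpace`). -/

noncomputable section

namespace FockBL

/-! ### Summation over words, graded by length -/

section LevelSums

variable {d : ℕ} {G : Type*}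

/-- The sum of `φ` over the words of length `n`. -/
def levelSum [AddCommMonoid G] (n : ℕ) (φ : Word d → G) : G :=
  ∑ i : Fin n → Fin d, φ (List.ofFn i)

theorem levelSum_zero [AddCommMonoid G] (φ : Word d → G) : levelSum 0 φ = φ [] := by
  simp [levelSum]

theorem levelSum_succ [AddCommMonoid G] (n : ℕ) (φ : Word d → G) :
    levelSum (n + 1) φ = ∑ j, levelSum n (fun v => φ (j :: v)) := by
  unfold levelSum
  rw [← (Fin.consEquiv (fun _ : Fin (n + 1) => Fin d)).sum_comp, Fintype.sum_prod_type]
  refine Finset.sum_congr rfl fun j _ => Finset.sum_congr rfl fun i _ => ?_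
  congr 1
  simp [Fin.consEquiv, List.ofFn_succ]

theorem levelSum_sum [AddCommMonoid G] {κ : Type*} (s : Finset κ) (n : ℕ) (φ : κ → Word d → G) :
    levelSum n (fun v => ∑ k ∈ s, φ k v) = ∑ k ∈ s, levelSum n (φ k) :=
  Finset.sum_comm

theorem levelSum_succ' [AddCommMonoid G] (n : ℕ) (φ : Word d → G) :
    levelSum (n + 1) φ = levelSum n (fun v => ∑ j, φ (j :: v)) := by
  rw [levelSum_succ, levelSum_sum]

theorem levelSum_add_index [AddCommMonoid G] (m n : ℕ) (φ : Word d → G) :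
    levelSum (m + n) φ = levelSum m (fun u => levelSum n (fun w => φ (u ++ w))) := by
  induction m generalizing φ with
  | zero => simp [levelSum_zero]
  | succ m ih =>
    rw [Nat.add_right_comm, levelSum_succ, levelSum_succ]
    exact Finset.sum_congr rfl fun j _ => ih _

theorem levelSum_succ_right [AddCommMonoid G] (n : ℕ) (φ : Word d → G) :
    levelSum (n + 1) φ = ∑ j, levelSum n (fun v => φ (v ++ [j])) := by
  rw [levelSum_add_index, ← levelSum_sum]
  congr 1
  ext u
  rw [levelSum_succ]
  simp [levelSum_zero]

theorem levelSum_add [AddCommMonoid G] (n : ℕ) (φ ψ : Word d → G) :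
    levelSum n (fun v => φ v + ψ v) = levelSum n φ + levelSum n ψ :=
  Finset.sum_add_distrib

theorem levelSum_sub [AddCommGroup G] (n : ℕ) (φ ψ : Word d → G) :
    levelSum n (fun v => φ v - ψ v) = levelSum n φ - levelSum n ψ :=
  Finset.sum_sub_distrib ..

theorem levelSum_mono (n : ℕ) {φ ψ : Word d → ℝ} (h : ∀ v, φ v ≤ ψ v) :
    levelSum n φ ≤ levelSum n ψ :=
  Finset.sum_le_sum fun _ _ => h _

theorem levelSum_nonneg (n : ℕ) {φ : Word d → ℝ} (h : ∀ v, 0 ≤ φ v) : 0 ≤ levelSum n φ :=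
  Finset.sum_nonneg fun _ _ => h _

theorem hasSum_levelSum [AddCommMonoid G] [TopologicalSpace G] [ContinuousAdd G] [RegularSpace G]
    {φ : Word d → G} {a : G} (h : HasSum φ a) : HasSum (fun n => levelSum n φ) a := by
  have h' := (List.equivSigmaTuple (α := Fin d)).symm.hasSum_iff.mpr h
  exact h'.sigma fun n => hasSum_fintype _

theorem summable_of_sum_levelSum_le {φ : Word d → ℝ} (h0 : ∀ v, 0 ≤ φ v) {c : ℝ}
    (h : ∀ N, ∑ n ∈ Finset.range N, levelSum n φ ≤ c) : Summable φ := by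
  rw [← (List.equivSigmaTuple (α := Fin d)).symm.summable_iff,
    summable_sigma_of_nonneg (f := φ ∘ _) (fun _ => h0 _)]
  refine ⟨fun n => (hasSum_fintype _).summable, ?_⟩
  refine summable_of_sum_range_le (c := c) (fun n => tsum_nonneg fun _ => h0 _) fun N => ?_
  simp only [tsum_fintype]
  exact h N

theorem tsum_le_of_sum_levelSum_le {φ : Word d → ℝ} (h0 : ∀ v, 0 ≤ φ v) {c : ℝ}
    (h : ∀ N, ∑ n ∈ Finset.range N, levelSum n φ ≤ c) : ∑' v, φ v ≤ c :=
  le_of_tendsto' (hasSum_levelSum (summable_of_sum_levelSum_le h0 h).hasSum).tendsto_sum_nat h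

theorem sum_levelSum_le_tsum {φ : Word d → ℝ} (h0 : ∀ v, 0 ≤ φ v) (h : Summable φ) (N : ℕ) :
    ∑ n ∈ Finset.range N, levelSum n φ ≤ ∑' v, φ v :=
  sum_le_hasSum _ (fun n _ => levelSum_nonneg n h0) (hasSum_levelSum h.hasSum)

end LevelSums

/-! ### Norms and left quotients in the Fock space -/

section FockSpace

variable {d : ℕ} {F G : Type*} [NormedAddCommGroup F] [NormedAddCommGroup G]

theorem hasSum_norm_sq (f : Fock d F) : HasSum (fun v => ‖f v‖ ^ 2) (‖f‖ ^ 2) := by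
  simpa using lp.hasSum_norm (p := 2) (by simp) f

theorem memℓp_two_iff {f : Word d → F} : Memℓp f 2 ↔ Summable fun v => ‖f v‖ ^ 2 := by
  simpa using memℓp_gen_iff (p := 2) (by simp) (f := f)

theorem sum_levelSum_norm_sq_le (f : Fock d F) (N : ℕ) :
    ∑ n ∈ Finset.range N, levelSum n (fun v => ‖f v‖ ^ 2) ≤ ‖f‖ ^ 2 := by
  rw [← (hasSum_norm_sq f).tsum_eq]
  exact sum_levelSum_le_tsum (fun _ => by positivity) (hasSum_norm_sq f).summable N

/-- A linear family of coefficients whose square sums are bounded by `‖x‖²` is a contraction into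
the Fock space. -/
theorem exists_contraction_of_coeff [InnerProductSpace ℂ F] [InnerProductSpace ℂ G]
    (φ : G →ₗ[ℂ] (Word d → F))
    (h : ∀ x N, ∑ n ∈ Finset.range N, levelSum n (fun v => ‖φ x v‖ ^ 2) ≤ ‖x‖ ^ 2) :
    ∃ M : G →L[ℂ] Fock d F, (∀ x v, M x v = φ x v) ∧ ‖M‖ ≤ 1 := by
  have hmem : ∀ x, Memℓp (φ x) 2 := fun x =>
    memℓp_two_iff.mpr (summable_of_sum_levelSum_le (fun _ => by positivity) (h x))
  let L : G →ₗ[ℂ] Fock d F :=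
    { toFun := fun x => ⟨φ x, hmem x⟩
      map_add' := fun x y => Subtype.ext (φ.map_add x y)
      map_smul' := fun c x => Subtype.ext (φ.map_smul c x) }
  have hL : ∀ x v, L x v = φ x v := fun _ _ => rfl
  have hb : ∀ x, ‖L x‖ ≤ 1 * ‖x‖ := fun x => by
    rw [one_mul]
    refine le_of_sq_le_sq ?_ (norm_nonneg _)
    rw [← (hasSum_norm_sq (L x)).tsum_eq]
    exact tsum_le_of_sum_levelSum_le (fun _ => by positivity) (h x)
  exact ⟨L.mkContinuous 1 hb, hL, L.mkContinuous_norm_le zero_le_one hb⟩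

/-- The coefficients `u ↦ f_{uv}`. -/
def leftQuotient (f : Fock d F) (v : Word d) : Fock d F :=
  ⟨fun u => f (u ++ v), memℓp_two_iff.mpr
    ((hasSum_norm_sq f).summable.comp_injective (List.append_left_injective v))⟩

/-- Each word of length at least `N` factors uniquely as `uv` with `|v| = N`, so the left side
counts part of `‖f‖²` once. -/
theorem levelSum_norm_sq_leftQuotient_le (f : Fock d F) (N : ℕ) :
    levelSum N (fun v => ‖leftQuotient f v‖ ^ 2) ≤ ‖f‖ ^ 2 := by
  have h : HasSum (fun m => levelSum N fun v => levelSum m fun u => ‖f (u ++ v)‖ ^ 2)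
      (levelSum N (fun v => ‖leftQuotient f v‖ ^ 2)) :=
    hasSum_sum fun i _ => hasSum_levelSum (hasSum_norm_sq (leftQuotient f (List.ofFn i)))
  refine le_of_tendsto' h.tendsto_sum_nat fun M => ?_
  refine le_trans ?_ (sum_levelSum_norm_sq_le f (M + N))
  have e : ∀ m, (levelSum N fun v => levelSum m fun u => ‖f (u ++ v)‖ ^ 2)
      = levelSum (m + N) (fun v => ‖f v‖ ^ 2) := fun m => by
    rw [levelSum_add_index]
    exact Finset.sum_comm
  simp only [e]
  rw [Finset.range_eq_Ico, Finset.sum_Ico_add' (fun m => levelSum m fun v => ‖f v‖ ^ 2) 0 M N]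
  refine Finset.sum_le_sum_of_subset_of_nonneg (fun i hi => by simp at hi ⊢; omega)
    fun n _ _ => levelSum_nonneg n fun _ => by positivity

end FockSpace

/-! ### Columns and the Cholesky factorization of the defect -/

section ColumnOperators

variable {d : ℕ} {E V F : Type*}

/-- The element of `E^d ⊕ F` with components `a` and `b`. -/
def mkOut (a : Fin d → E) (b : F) : WithLp 2 (PiLp 2 (fun _ : Fin d => E) × F) :=
  WithLp.toLp 2 (WithLp.toLp 2 a, b)

theorem mkOut_injective {a a' : Fin d → E} {b b' : F} (h : mkOut a b = mkOut a' b') :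
    a = a' ∧ b = b' := by
  simpa [mkOut] using h

variable [NormedAddCommGroup E] [NormedAddCommGroup F]

theorem mkOut_add (a a' : Fin d → E) (b b' : F) :
    mkOut (fun j => a j + a' j) (b + b') = mkOut a b + mkOut a' b' := rfl

theorem norm_sq_mkOut (a : Fin d → E) (b : F) :
    ‖mkOut a b‖ ^ 2 = ∑ j, ‖a j‖ ^ 2 + ‖b‖ ^ 2 := by
  rw [WithLp.prod_norm_sq_eq_of_L2, PiLp.norm_sq_eq_of_L2]
  rfl

variable [NormedAddCommGroup V] [InnerProductSpace ℂ E] [InnerProductSpace ℂ V]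
  [InnerProductSpace ℂ F]

theorem col_apply (B : Fin d → V →L[ℂ] E) (D : V →L[ℂ] F) (u : V) :
    col B D u = mkOut (fun j => B j u) (D u) := rfl

theorem exists_eq_col (W : V →L[ℂ] OutSpace d E F) :
    ∃ (B : Fin d → V →L[ℂ] E) (D : V →L[ℂ] F), col B D = W := by
  let e := WithLp.prodContinuousLinearEquiv 2 ℂ (PiLp 2 (fun _ : Fin d => E)) F
  refine ⟨fun j => PiLp.proj 2 (fun _ : Fin d => E) j ∘L ContinuousLinearMap.fst ℂ _ _ ∘L
    e.toContinuousLinearMap ∘L W, ContinuousLinearMap.snd ℂ _ _ ∘L e.toContinuousLinearMap ∘L W, ?_⟩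
  ext u
  rfl

variable [CompleteSpace E] [CompleteSpace F] [CompleteSpace V]

theorem adjoint_col_mkOut (B : Fin d → V →L[ℂ] E) (D : V →L[ℂ] F) (a : Fin d → E) (b : F) :
    adjoint (col B D) (mkOut a b) = ∑ j, adjoint (B j) (a j) + adjoint D b := by
  refine ext_inner_right ℂ fun u => ?_
  rw [adjoint_inner_left, inner_add_left, sum_inner]
  simp only [adjoint_inner_left]
  rw [WithLp.prod_inner_apply, PiLp.inner_apply]
  rfl

section Cholesky

variable {A : Fin d → E →L[ℂ] E} {C : E →L[ℂ] F} {B : Fin d → V →L[ℂ] E} {D : V →L[ℂ] F}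

theorem IsCholesky.apply (h : IsCholesky A C B D) (y : OutSpace d E F) :
    col A C (adjoint (col A C) y) + col B D (adjoint (col B D) y) = y := by
  have := DFunLike.congr_fun h y
  simp only [defect, comp_apply, sub_apply] at this
  rw [this]; abel

theorem IsCholesky.norm_sq_add_norm_sq (h : IsCholesky A C B D) (y : OutSpace d E F) :
    ‖adjoint (col A C) y‖ ^ 2 + ‖adjoint (col B D) y‖ ^ 2 = ‖y‖ ^ 2 := by
  have := congrArg (fun z => RCLike.re (inner ℂ z y)) (h.apply y)
  rwa [inner_add_left, ← adjoint_inner_right (col A C), ← adjoint_inner_right (col B D), map_add,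
    inner_self_eq_norm_sq, inner_self_eq_norm_sq, inner_self_eq_norm_sq] at this

theorem IsCholesky.coisometric (h : IsCholesky A C B D) :
    colligation A B C D ∘L adjoint (colligation A B C D) = 1 := by
  ext1 y
  have key : adjoint (colligation A B C D) y
      = WithLp.toLp 2 (adjoint (col A C) y, adjoint (col B D) y) := by
    refine ext_inner_right ℂ fun u => ?_
    rw [adjoint_inner_left, WithLp.prod_inner_apply]
    change _ = inner ℂ (adjoint (col A C) y) u.fst + inner ℂ (adjoint (col B D) y) u.snd
    rw [adjoint_inner_left, adjoint_inner_left, ← inner_add_right]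
    rfl
  rw [comp_apply, key]
  exact h.apply y

/-- In `‖[A; C]* y‖² + ‖[B; D]* y‖² = ‖y‖²` a vector `y = [A; C] x` already exhausts the norm with
the first term, so the second one vanishes. -/
theorem IsCholesky.adjoint_col_comp_col (h : IsCholesky A C B D)
    (hiso : adjoint (col A C) ∘L col A C = 1) (u : V) : adjoint (col A C) (col B D u) = 0 := by
  have h1 : ∀ x, adjoint (col B D) (col A C x) = 0 := fun x => by
    have h2 := h.norm_sq_add_norm_sq (col A C x)
    have h3 : adjoint (col A C) (col A C x) = x := DFunLike.congr_fun hiso x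
    have h4 : ‖col A C x‖ = ‖x‖ := (norm_map_iff_adjoint_comp_self _).mpr hiso x
    rw [h3, h4] at h2
    simpa using h2
  refine ext_inner_right ℂ fun x => ?_
  rw [adjoint_inner_left, ← adjoint_inner_right, h1, inner_zero_left, inner_zero_right]

theorem IsCholesky.norm_col_le (h : IsCholesky A C B D) (u : V) : ‖col B D u‖ ≤ ‖u‖ := by
  have h1 : ‖adjoint (col B D)‖ ≤ 1 := opNorm_le_bound _ zero_le_one fun y => by
    rw [one_mul]
    refine le_of_sq_le_sq ?_ (norm_nonneg _)
    have := h.norm_sq_add_norm_sq y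
    nlinarith [sq_nonneg ‖adjoint (col A C) y‖]
  rw [LinearIsometryEquiv.norm_map] at h1
  simpa using le_of_opNorm_le _ h1 u

/-- With `W = [B; D]`, the Cholesky equation and orthogonality give `W W* W = W`; cancelling the
injective `W` on the left leaves `W* W = 1`. -/
theorem IsCholesky.norm_col_eq (h : IsCholesky A C B D)
    (hiso : adjoint (col A C) ∘L col A C = 1) (hinj : Function.Injective (col B D)) (u : V) :
    ‖col B D u‖ = ‖u‖ := by
  refine (norm_map_iff_adjoint_comp_self _).mpr (ContinuousLinearMap.ext fun u => hinj ?_) u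
  have := h.apply (col B D u)
  rw [h.adjoint_col_comp_col hiso, map_zero, zero_add] at this
  simpa using this

theorem IsCholesky.norm_sq_col_add_col (h : IsCholesky A C B D)
    (hiso : adjoint (col A C) ∘L col A C = 1) (x : E) (u : V) :
    ‖col A C x + col B D u‖ ^ 2 = ‖x‖ ^ 2 + ‖col B D u‖ ^ 2 := by
  have h1 : inner ℂ (col A C x) (col B D u) = 0 := by
    rw [← adjoint_inner_right, h.adjoint_col_comp_col hiso, inner_zero_right]
  rw [sq, norm_add_sq_eq_norm_sq_add_norm_sq_of_inner_eq_zero _ _ h1,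
    (norm_map_iff_adjoint_comp_self _).mpr hiso x]
  ring

theorem defect_idempotent (hiso : adjoint (col A C) ∘L col A C = 1) (y : OutSpace d E F) :
    defect A C (defect A C y) = defect A C y := by
  have h3 : ∀ x, adjoint (col A C) (col A C x) = x := DFunLike.congr_fun hiso
  simp [defect, h3]

/-- The defect is `W W*` with `W = [B; D]`, so its range lies in that of `W`. Equal dimensions and
rank-nullity leave no room for a kernel. -/
theorem IsCholesky.injective_of_finiteDimensional (h : IsCholesky A C B D)
    (hdim : DimEqRank V (defect A C))
    [FiniteDimensional ℂ V] : Function.Injective (col B D) := by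
  obtain ⟨ι, ⟨b⟩, ⟨b'⟩⟩ := hdim
  have hfin : Finite ι := b.orthonormal.linearIndependent.finite
  have := Fintype.ofFinite ι
  have e1 := Module.finrank_eq_card_basis b.toOrthonormalBasis.toBasis
  have e2 := Module.finrank_eq_card_basis b'.toOrthonormalBasis.toBasis
  have hfd : FiniteDimensional ℂ (LinearMap.range (defect A C).toLinearMap).topologicalClosure :=
    b'.toOrthonormalBasis.toBasis.finiteDimensional_of_finite
  have hle : (LinearMap.range (defect A C).toLinearMap).topologicalClosure
      ≤ LinearMap.range (col B D).toLinearMap := by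
    refine Submodule.topologicalClosure_minimal _ ?_ (Submodule.closed_of_finiteDimensional _)
    rintro _ ⟨y, rfl⟩
    exact ⟨adjoint (col B D) y, DFunLike.congr_fun h y⟩
  have e3 := Submodule.finrank_mono hle
  have e4 := LinearMap.finrank_range_add_finrank_ker (col B D).toLinearMap
  have e5 : Module.finrank ℂ (LinearMap.ker (col B D).toLinearMap) = 0 := by omega
  exact LinearMap.ker_eq_bot.mp (Submodule.finrank_eq_zero.mp e5)

end Cholesky

end ColumnOperators

/-- For isometric `[A; C]` the defect is an orthogonal projection, and the inclusion of its range
factors it. -/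
theorem exists_isCholesky {d : ℕ} {E : Type u} [NormedAddCommGroup E] [InnerProductSpace ℂ E]
    [CompleteSpace E] {F : Type v} [NormedAddCommGroup F] [InnerProductSpace ℂ F] [CompleteSpace F]
    {A : Fin d → E →L[ℂ] E} {C : E →L[ℂ] F} (hiso : adjoint (col A C) ∘L col A C = 1) :
    ∃ (V : Type (max u v)) (_ : NormedAddCommGroup V) (_ : InnerProductSpace ℂ V)
      (_ : CompleteSpace V) (B : Fin d → V →L[ℂ] E) (D : V →L[ℂ] F),
      DimEqRank V (defect A C) ∧ IsCholesky A C B D ∧ Function.Injective (col B D) := by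
  let R := (LinearMap.range (defect A C).toLinearMap).topologicalClosure
  have hR : IsClosed (R : Set (OutSpace d E F)) := Submodule.isClosed_topologicalClosure _
  have : CompleteSpace R := hR.completeSpace_coe
  obtain ⟨B, D, hBD⟩ := exists_eq_col (d := d) (E := E) (F := F) (V := R) R.subtypeL
  have hcol : ∀ u, col B D u = u := fun u => DFunLike.congr_fun hBD u
  obtain ⟨w, b, -⟩ := exists_hilbertBasis ℂ R
  refine ⟨R, inferInstance, inferInstance, this, B, D, ⟨w, ⟨b⟩, ⟨b⟩⟩, ?_, ?_⟩
  · have hker : ∀ y ∈ R, defect A C y = y := by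
      intro y hy
      have hc : IsClosed {y | defect A C y = y} :=
        isClosed_eq (defect A C).continuous continuous_id
      refine closure_minimal ?_ hc hy
      rintro _ ⟨z, rfl⟩
      exact defect_idempotent hiso z
    have hsa : adjoint (defect A C) = defect A C := by
      ext1 y
      refine ext_inner_right ℂ fun z => ?_
      rw [adjoint_inner_left]
      simp [defect, inner_sub_left, inner_sub_right, ← adjoint_inner_right]
    ext1 y
    let q : R := ⟨defect A C y, Submodule.le_topologicalClosure _ ⟨y, rfl⟩⟩
    have hq : adjoint (col B D) y = q := by
      refine ext_inner_right ℂ fun z => ?_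
      rw [adjoint_inner_left, Submodule.coe_inner, hcol]
      change inner ℂ y (z : OutSpace d E F) = inner ℂ (defect A C y) z
      rw [← adjoint_inner_right, hsa, hker z z.2]
    rw [comp_apply, hq, hcol]
  · intro u u' h
    rw [hcol, hcol] at h
    exact Subtype.ext h

/-! ### The system on words and its energy balance -/

section StateSpace

variable {d : ℕ} {E V F : Type*} [NormedAddCommGroup E] [InnerProductSpace ℂ E]
  [NormedAddCommGroup V] [InnerProductSpace ℂ V] [NormedAddCommGroup F] [InnerProductSpace ℂ F]

theorem wpow_nil (A : Fin d → E →L[ℂ] E) : wpow A [] = 1 := rfl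

theorem wpow_cons (A : Fin d → E →L[ℂ] E) (j : Fin d) (v : Word d) :
    wpow A (j :: v) = A j ∘L wpow A v := by
  simp [wpow]; rfl

theorem wpow_append (A : Fin d → E →L[ℂ] E) (u v : Word d) :
    wpow A (u ++ v) = wpow A u ∘L wpow A v := by
  simp [wpow]; rfl

/-- The state of the system `x_{jv} = A_j x_v + B_j f_v` with `x_∅ = 0`. -/
def state (A : Fin d → E →L[ℂ] E) (B : Fin d → V →L[ℂ] E) (f : Word d → V) : Word d → E
  | [] => 0
  | j :: v => A j (state A B f v) + B j (f v)

/-- The coefficient of `z^v` in `(I - Z(z) A)⁻¹ Z(z) B`. -/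
def inputState (A : Fin d → E →L[ℂ] E) (B : Fin d → V →L[ℂ] E) (v : Word d) : V →L[ℂ] E :=
  if h : v = [] then 0 else wpow A v.dropLast ∘L B (v.getLast h)

theorem inputState_cons (A : Fin d → E →L[ℂ] E) (B : Fin d → V →L[ℂ] E) (j : Fin d) {v : Word d}
    (hv : v ≠ []) : inputState A B (j :: v) = A j ∘L inputState A B v := by
  simp only [inputState, hv, dif_neg, not_false_eq_true, reduceCtorEq, List.getLast_cons hv,
    List.dropLast_cons_of_ne_nil hv, wpow_cons]
  rfl

theorem state_eq_sum (A : Fin d → E →L[ℂ] E) (B : Fin d → V →L[ℂ] E) (f : Word d → V)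
    (v : Word d) : state A B f v
      = ∑ k ∈ Finset.range v.length, inputState A B (v.take (k + 1)) (f (v.drop (k + 1))) := by
  induction v with
  | nil => simp [state]
  | cons j v ih =>
    rw [List.length_cons, Finset.sum_range_succ', state, ih, map_sum]
    congr 1
    refine Finset.sum_congr rfl fun k hk => ?_
    have hv : v ≠ [] := by rintro rfl; simp at hk
    rw [List.take_succ_cons, List.drop_succ_cons, inputState_cons _ _ _ (by simp [hv])]
    rfl

theorem mulCoeff_transfer (A : Fin d → E →L[ℂ] E) (B : Fin d → V →L[ℂ] E) (C : E →L[ℂ] F)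
    (D : V →L[ℂ] F) (f : Word d → V) (v : Word d) :
    mulCoeff (transfer A B C D) f v = C (state A B f v) + D (f v) := by
  rw [mulCoeff, Finset.sum_range_succ', state_eq_sum, map_sum]
  congr 1
  refine Finset.sum_congr rfl fun k hk => ?_
  have hv : v.take (k + 1) ≠ [] := by
    have : v ≠ [] := by rintro rfl; simp at hk
    simp [this]
  simp [transfer, inputState, hv]

theorem state_add (A : Fin d → E →L[ℂ] E) (B : Fin d → V →L[ℂ] E) (f g : Word d → V)
    (v : Word d) : state A B (f + g) v = state A B f v + state A B g v := by
  induction v with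
  | nil => simp [state]
  | cons j v ih => simp only [state, ih, map_add, Pi.add_apply]; abel

theorem state_smul (A : Fin d → E →L[ℂ] E) (B : Fin d → V →L[ℂ] E) (c : ℂ) (f : Word d → V)
    (v : Word d) : state A B (c • f) v = c • state A B f v := by
  induction v with
  | nil => simp [state]
  | cons j v ih => simp only [state, ih, map_smul, Pi.smul_apply, smul_add]

/-- Once the input has died out, the state evolves freely under `𝐀`. -/
theorem state_append (A : Fin d → E →L[ℂ] E) (B : Fin d → V →L[ℂ] E) {f : Word d → V} {n : ℕ}
    (hf : ∀ v, n ≤ v.length → f v = 0) (u : Word d) {w : Word d} (hw : n ≤ w.length) :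
    state A B f (u ++ w) = wpow A u (state A B f w) := by
  induction u with
  | nil => rfl
  | cons j u ih =>
    rw [List.cons_append, state, ih, hf (u ++ w) (by simp; omega), map_zero, add_zero, wpow_cons]
    rfl

section Energy

variable {A : Fin d → E →L[ℂ] E} {C : E →L[ℂ] F} {B : Fin d → V →L[ℂ] E} {D : V →L[ℂ] F}

/-- The input cost `p` is left free: `‖[B; D] u‖²` in general, `‖u‖²` when `[B; D]` is isometric. -/
theorem sum_levelSum_output_add_levelSum_state
    (p : V → ℝ) (hU : ∀ x u, ‖col A C x + col B D u‖ ^ 2 = ‖x‖ ^ 2 + p u) (f : Word d → V) (N : ℕ) :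
    ∑ n ∈ Finset.range N, levelSum n (fun v => ‖C (state A B f v) + D (f v)‖ ^ 2)
      + levelSum N (fun v => ‖state A B f v‖ ^ 2)
      = ∑ n ∈ Finset.range N, levelSum n (fun v => p (f v)) := by
  induction N with
  | zero => simp [levelSum_zero, state]
  | succ N ih =>
    rw [Finset.sum_range_succ, Finset.sum_range_succ, ← ih, levelSum_succ', add_assoc, add_assoc,
      ← levelSum_add, ← levelSum_add]
    congr 2
    ext v
    rw [← hU, col_apply, col_apply, ← mkOut_add, norm_sq_mkOut, add_comm]
    rfl

theorem tendsto_levelSum_state (hA : StronglyStable A) {f : Word d → V} {n : ℕ}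
    (hf : ∀ v, n ≤ v.length → f v = 0) :
    Tendsto (fun N => levelSum N (fun v => ‖state A B f v‖ ^ 2)) atTop (𝓝 0) := by
  rw [← tendsto_add_atTop_iff_nat n]
  have h : ∀ m, levelSum (m + n) (fun v => ‖state A B f v‖ ^ 2)
      = levelSum n (fun w => levelSum m fun u => ‖wpow A u (state A B f w)‖ ^ 2) := fun m => by
    rw [levelSum_add_index]
    refine Finset.sum_comm.trans ?_
    refine Finset.sum_congr rfl fun i _ => Finset.sum_congr rfl fun k _ => ?_
    beta_reduce
    rw [state_append A B hf _ (by simp)]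
  simp only [h]
  have := tendsto_finsetSum (Finset.univ : Finset (Fin n → Fin d))
    fun i _ => hA (state A B f (List.ofFn i))
  rwa [Finset.sum_const_zero] at this

theorem isSchur_transfer (p : V → ℝ) (hp : ∀ u, p u ≤ ‖u‖ ^ 2)
    (hU : ∀ x u, ‖col A C x + col B D u‖ ^ 2 = ‖x‖ ^ 2 + p u) : IsSchur (transfer A B C D) := by
  let φ : Fock d V →ₗ[ℂ] (Word d → F) :=
    { toFun := fun f v => C (state A B f v) + D (f v)
      map_add' := fun f g => by
        ext v
        simp only [lp.coeFn_add, state_add, map_add, Pi.add_apply]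
        abel
      map_smul' := fun c f => by
        ext v
        simp only [lp.coeFn_smul, state_smul, map_smul, Pi.smul_apply, smul_add, RingHom.id_apply] }
  obtain ⟨M, hM, hM1⟩ := exists_contraction_of_coeff φ fun f N => by
    have h1 := sum_levelSum_output_add_levelSum_state p hU f N
    have h2 := levelSum_nonneg N (φ := fun v => ‖state A B f v‖ ^ 2) fun _ => by positivity
    have h3 : ∑ n ∈ Finset.range N, levelSum n (fun v => p (f v))
        ≤ ∑ n ∈ Finset.range N, levelSum n (fun v => ‖f v‖ ^ 2) :=
      Finset.sum_le_sum fun n _ => levelSum_mono n fun _ => hp _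
    have h4 := sum_levelSum_norm_sq_le f N
    change ∑ n ∈ Finset.range N, levelSum n (fun v => ‖C (state A B f v) + D (f v)‖ ^ 2) ≤ _
    linarith
  exact ⟨M, fun f v => (hM f v).trans (mulCoeff_transfer A B C D f v).symm, hM1⟩

theorem isInner_transfer (hA : StronglyStable A)
    (hU : ∀ x u, ‖col A C x + col B D u‖ ^ 2 = ‖x‖ ^ 2 + ‖u‖ ^ 2) :
    IsInner (transfer A B C D) := by
  classical
  obtain ⟨M, hM, hM1⟩ := isSchur_transfer (fun u => ‖u‖ ^ 2) (fun _ => le_rfl) hU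
  refine ⟨M, hM, hM1, AddMonoidHomClass.isometry_of_norm M fun f => ?_⟩
  have hfin : ∀ (f : Fock d V) (n : ℕ), (∀ v, n ≤ v.length → f v = 0) → ‖M f‖ = ‖f‖ := by
    intro f n hf
    have h1 := (hasSum_levelSum (hasSum_norm_sq (M f))).tendsto_sum_nat.add
      (tendsto_levelSum_state (B := B) hA hf)
    have h2 := (hasSum_levelSum (hasSum_norm_sq f)).tendsto_sum_nat
    have h3 := fun N => sum_levelSum_output_add_levelSum_state _ hU f N
    simp only [hM f _, mulCoeff_transfer, h3, add_zero] at h1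
    exact (sq_eq_sq₀ (norm_nonneg _) (norm_nonneg _)).mp (tendsto_nhds_unique h1 h2)
  -- Finitely supported inputs are dense; the input restricted to `s` vanishes beyond the longest
  -- word of `s`.
  have hs := lp.hasSum_single (p := 2) (by simp) f
  refine tendsto_nhds_unique ((M.continuous.tendsto f).comp hs).norm ?_
  refine hs.norm.congr fun s => (hfin _ (s.sup List.length + 1) fun v hv => ?_).symm
  rw [lp.coeFn_sum, Finset.sum_apply]
  refine Finset.sum_eq_zero fun u hu => lp.single_apply_ne _ _ _ ?_
  rintro rfl
  have := Finset.le_sup (f := List.length) hu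
  omega

end Energy

theorem interpSpace_shift {Z : Fin d → E →L[ℂ] E} {X : F →L[ℂ] E} (j : Fin d)
    {f g : Fock d F} (hf : f ∈ interpSpace Z X)
    (hg : ∀ a, g a = shiftCoeff j f a) : g ∈ interpSpace Z X := by
  have h1 : HasSum (fun v => Z j (ctrlTerm Z X f v)) 0 := by
    simpa using (Z j).hasSum hf
  refine ((List.append_left_injective [j]).hasSum_iff fun v hv => ?_).mp (h1.congr_fun ?_)
  · rw [ctrlTerm, hg, shiftCoeff, if_neg, map_zero, map_zero]
    rw [List.getLast?_eq_some_iff]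
    rintro ⟨u, rfl⟩
    exact hv ⟨u, rfl⟩
  · intro v
    simp [ctrlTerm, hg, shiftCoeff, wpow_cons]

/-- Split off `u = ∅` and sort the other words by their last letter: `u = u'j` gives `uv = u'(jv)`
and `𝐙^{u⊤} = Z_j 𝐙^{u'⊤}`. -/
theorem control_leftQuotient {Z : Fin d → E →L[ℂ] E} {X : F →L[ℂ] E}
    {Γ : Fock d F →L[ℂ] E} (hΓ : ∀ f, HasSum (ctrlTerm Z X f) (Γ f))
    (g : Fock d F) (v : Word d) :
    Γ (leftQuotient g v) = ∑ j, Z j (Γ (leftQuotient g (j :: v))) + X (g v) := by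
  have h1 := (hasSum_levelSum (hΓ (leftQuotient g v))).tendsto_sum_nat.comp (tendsto_add_atTop_nat 1)
  have h2 := tendsto_finsetSum (Finset.univ : Finset (Fin d)) fun j _ =>
    ((Z j).continuous.tendsto _).comp
      (hasSum_levelSum (hΓ (leftQuotient g (j :: v)))).tendsto_sum_nat
  refine tendsto_nhds_unique h1 ((h2.add_const (X (g v))).congr fun N => ?_)
  simp only [Function.comp_apply]
  rw [Finset.sum_range_succ', levelSum_zero]
  congr 1
  simp only [map_sum, levelSum_succ_right]
  rw [Finset.sum_comm]
  refine Finset.sum_congr rfl fun n _ => Finset.sum_congr rfl fun j _ => ?_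
  simp only [levelSum, map_sum]
  refine Finset.sum_congr rfl fun i _ => ?_
  simp [ctrlTerm, wpow_cons, leftQuotient]

end StateSpace

/-! ### Observability and control operators -/

section Control

variable {d : ℕ} {E V F : Type*} [NormedAddCommGroup E] [InnerProductSpace ℂ E] [CompleteSpace E]
  [NormedAddCommGroup V] [InnerProductSpace ℂ V] [CompleteSpace V]
  [NormedAddCommGroup F] [InnerProductSpace ℂ F] [CompleteSpace F]

theorem wpow_reverse_eq_adjoint (Z : Fin d → E →L[ℂ] E) (v : Word d) :
    wpow Z v.reverse = adjoint (wpow (fun j => adjoint (Z j)) v) := by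
  induction v with
  | nil => ext1 x; refine ext_inner_right ℂ fun y => ?_; rw [adjoint_inner_left]; rfl
  | cons j v ih =>
    rw [List.reverse_cons, wpow_append, ih, wpow_cons _ _ v, adjoint_comp, adjoint_adjoint, wpow_cons]
    rfl

variable {Z : Fin d → E →L[ℂ] E} {X : F →L[ℂ] E}

theorem IsAdmissible.adjoint_col_comp_col_self (h : IsAdmissible Z X) :
    adjoint (col (fun j => adjoint (Z j)) (adjoint X)) ∘L col (fun j => adjoint (Z j)) (adjoint X)
      = 1 := by
  ext1 x
  have := DFunLike.congr_fun h.isometric x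
  simp only [sub_apply, sum_apply, comp_apply] at this
  rw [comp_apply, col_apply, adjoint_col_mkOut]
  simp only [adjoint_adjoint]
  rw [← this]
  abel

theorem IsAdmissible.sum_levelSum_observe_le (h : IsAdmissible Z X) (x : E) (N : ℕ) :
    ∑ n ∈ Finset.range N, levelSum n
      (fun v => ‖adjoint X (wpow (fun j => adjoint (Z j)) v x)‖ ^ 2) ≤ ‖x‖ ^ 2 := by
  set A : Fin d → E →L[ℂ] E := fun j => adjoint (Z j)
  have hiso : ∀ y, ∑ j, ‖A j y‖ ^ 2 + ‖adjoint X y‖ ^ 2 = ‖y‖ ^ 2 := fun y => by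
    rw [← norm_sq_mkOut, ← col_apply A (adjoint X),
      (norm_map_iff_adjoint_comp_self _).mpr h.adjoint_col_comp_col_self]
  have key : ∑ n ∈ Finset.range N, levelSum n (fun v => ‖adjoint X (wpow A v x)‖ ^ 2)
      + levelSum N (fun v => ‖wpow A v x‖ ^ 2) = ‖x‖ ^ 2 := by
    induction N with
    | zero => simp [levelSum_zero, wpow_nil]
    | succ N ih =>
      rw [Finset.sum_range_succ, add_assoc, levelSum_succ', ← levelSum_add, ← ih]
      congr 2
      ext v
      rw [← hiso, add_comm]
      simp only [wpow_cons, comp_apply]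
  have := levelSum_nonneg N (φ := fun v => ‖wpow A v x‖ ^ 2) fun _ => by positivity
  linarith

/-- The adjoint of the observability operator sends the `v`-th single-coefficient series to the
`v`-th term, so convergence is inherited from the expansion of `f` in the Fock space. -/
theorem IsAdmissible.exists_control (h : IsAdmissible Z X) :
    ∃ Γ : Fock d F →L[ℂ] E, (∀ f, HasSum (ctrlTerm Z X f) (Γ f)) ∧ ‖Γ‖ ≤ 1 := by
  classical
  let φ : E →ₗ[ℂ] (Word d → F) :=
    { toFun := fun x v => adjoint X (wpow (fun j => adjoint (Z j)) v x)
      map_add' := fun x y => by ext v; simp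
      map_smul' := fun c x => by ext v; simp }
  obtain ⟨O, hO, hO1⟩ := exists_contraction_of_coeff φ h.sum_levelSum_observe_le
  refine ⟨adjoint O, fun f => ?_, by rwa [LinearIsometryEquiv.norm_map]⟩
  have hs := (adjoint O).hasSum (lp.hasSum_single (p := 2) (by simp) f)
  convert hs using 2 with v
  refine ext_inner_right ℂ fun y => ?_
  rw [adjoint_inner_left, lp.inner_single_left, hO, ctrlTerm, wpow_reverse_eq_adjoint,
    adjoint_inner_left, ← adjoint_inner_right]
  rfl

end Control

/-! ### The range of the multiplier is the kernel of `𝒞` -/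

section BeurlingLax

variable {d : ℕ} {E V F : Type*} [NormedAddCommGroup E] [InnerProductSpace ℂ E] [CompleteSpace E]
  [NormedAddCommGroup V] [InnerProductSpace ℂ V] [CompleteSpace V]
  [NormedAddCommGroup F] [InnerProductSpace ℂ F] [CompleteSpace F]
  {Z : Fin d → E →L[ℂ] E} {X : F →L[ℂ] E} {B : Fin d → V →L[ℂ] E} {D : V →L[ℂ] F}

theorem sum_levelSum_ctrlTerm (h : IsAdmissible Z X)
    (hBD : IsCholesky (fun j => adjoint (Z j)) (adjoint X) B D) (f : Word d → V) (g : Fock d F)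
    (hg : ∀ v, g v = adjoint X (state (fun j => adjoint (Z j)) B f v) + D (f v)) (N : ℕ) :
    ∑ n ∈ Finset.range N, levelSum n (ctrlTerm Z X g)
      = - levelSum N (fun v => wpow Z v.reverse (state (fun j => adjoint (Z j)) B f v)) := by
  set A : Fin d → E →L[ℂ] E := fun j => adjoint (Z j) with hA
  -- This is `[A* C*]([A; C] x + [B; D] u) = x` written in components; it makes the sum telescope.
  have hstep : ∀ x u, X (adjoint X x + D u) = x - ∑ j, Z j (A j x + B j u) := fun x u => by
    have h1 : adjoint (col A (adjoint X)) (col A (adjoint X) x + col B D u) = x := by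
      rw [map_add, hBD.adjoint_col_comp_col h.adjoint_col_comp_col_self, add_zero]
      exact DFunLike.congr_fun h.adjoint_col_comp_col_self x
    rw [col_apply, col_apply, ← mkOut_add, adjoint_col_mkOut] at h1
    simp only [hA, adjoint_adjoint] at h1 ⊢
    exact eq_sub_of_add_eq' h1
  induction N with
  | zero => simp [levelSum_zero, state]
  | succ N ih =>
    rw [Finset.sum_range_succ, ih, levelSum_succ', neg_add_eq_iff_eq_add, ← sub_eq_add_neg,
      ← levelSum_sub]
    congr 1
    ext v
    rw [ctrlTerm, hg, hstep, map_sub, map_sum]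
    simp [wpow_append, wpow_cons, wpow_nil, state]

/-- Tested against `y`, the telescoped remainder is controlled by Cauchy-Schwarz: the state energy
stays below `‖f‖²`, while `∑_{|v| = N} ‖𝐀^v y‖²` tends to `0` by stability. -/
theorem mem_interpSpace_of_eq_output (h : IsAdmissible Z X)
    (hBD : IsCholesky (fun j => adjoint (Z j)) (adjoint X) B D) (f : Fock d V) (g : Fock d F)
    (hg : ∀ v, g v = adjoint X (state (fun j => adjoint (Z j)) B f v) + D (f v)) :
    g ∈ interpSpace Z X := by
  obtain ⟨Γ, hΓ, -⟩ := h.exists_control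
  suffices h0 : Γ g = 0 by
    have := hΓ g
    rwa [h0] at this
  set A : Fin d → E →L[ℂ] E := fun j => adjoint (Z j) with hA
  refine ext_inner_right ℂ fun y => ?_
  rw [inner_zero_left]
  have ht := (hasSum_levelSum (hΓ g)).tendsto_sum_nat
  simp only [sum_levelSum_ctrlTerm h hBD f g hg] at ht
  have h1 := (ht.inner (𝕜 := ℂ) (tendsto_const_nhds (x := y))).norm.pow 2
  have h2 : Tendsto (fun N => ‖f‖ ^ 2 * levelSum N (fun v => ‖wpow A v y‖ ^ 2)) atTop (𝓝 0) := by
    simpa only [mul_zero] using! (h.stable y).const_mul (‖f‖ ^ 2)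
  have h3 := le_of_tendsto_of_tendsto' h1 h2 fun N => ?_
  · simpa using h3
  have hst : levelSum N (fun v => ‖state A B f v‖ ^ 2) ≤ ‖f‖ ^ 2 := by
    have e1 := sum_levelSum_output_add_levelSum_state (fun u => ‖col B D u‖ ^ 2)
      (hBD.norm_sq_col_add_col h.adjoint_col_comp_col_self) f N
    have e2 : ∑ n ∈ Finset.range N, levelSum n (fun v => ‖col B D (f v)‖ ^ 2)
        ≤ ∑ n ∈ Finset.range N, levelSum n (fun v => ‖f v‖ ^ 2) :=
      Finset.sum_le_sum fun n _ => levelSum_mono n fun v =>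
        pow_le_pow_left₀ (norm_nonneg _) (hBD.norm_col_le _) 2
    have e3 := sum_levelSum_norm_sq_le f N
    have e4 : 0 ≤ ∑ n ∈ Finset.range N,
        levelSum n (fun v => ‖adjoint X (state A B f v) + D (f v)‖ ^ 2) :=
      Finset.sum_nonneg fun n _ => levelSum_nonneg n fun _ => by positivity
    linarith
  have hcs : ‖inner ℂ (-levelSum N fun v => wpow Z v.reverse (state A B f v)) y‖
      ≤ levelSum N (fun v => ‖state A B f v‖ * ‖wpow A v y‖) := by
    rw [inner_neg_left, norm_neg, levelSum, sum_inner]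
    refine (norm_sum_le _ _).trans (Finset.sum_le_sum fun i _ => ?_)
    rw [wpow_reverse_eq_adjoint, adjoint_inner_left]
    exact norm_inner_le_norm _ _
  calc _ ≤ levelSum N (fun v => ‖state A B f v‖ * ‖wpow A v y‖) ^ 2 :=
        pow_le_pow_left₀ (norm_nonneg _) hcs 2
    _ ≤ levelSum N (fun v => ‖state A B f v‖ ^ 2) * levelSum N (fun v => ‖wpow A v y‖ ^ 2) :=
        Finset.sum_mul_sq_le_sq_mul_sq _ _ _
    _ ≤ _ := mul_le_mul_of_nonneg_right hst (levelSum_nonneg N fun _ => by positivity)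

theorem exists_input_of_mem_interpSpace (h : IsAdmissible Z X)
    (hBD : IsCholesky (fun j => adjoint (Z j)) (adjoint X) B D) {g : Fock d F}
    (hg : g ∈ interpSpace Z X) :
    ∃ f : Fock d V, ∀ v, g v = adjoint X (state (fun j => adjoint (Z j)) B f v) + D (f v) := by
  obtain ⟨Γ, hΓ, hΓ1⟩ := h.exists_control
  set A : Fin d → E →L[ℂ] E := fun j => adjoint (Z j) with hA
  let x : Word d → E := fun v => Γ (leftQuotient g v)
  let y : Word d → OutSpace d E F := fun v => mkOut (fun j => x (j :: v)) (g v)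
  let f : Word d → V := fun v => adjoint (col B D) (y v)
  have hx : ∀ v, adjoint (col A (adjoint X)) (y v) = x v := fun v => by
    rw [adjoint_col_mkOut]
    simp only [hA, adjoint_adjoint]
    exact (control_leftQuotient hΓ g v).symm
  have hxle : ∀ v, ‖x v‖ ^ 2 ≤ ‖leftQuotient g v‖ ^ 2 := fun v =>
    pow_le_pow_left₀ (norm_nonneg _) (by simpa using Γ.le_of_opNorm_le hΓ1 (leftQuotient g v)) 2
  have hy : ∀ v, (∀ j, A j (x v) + B j (f v) = x (j :: v)) ∧ adjoint X (x v) + D (f v) = g v :=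
    fun v => by
      have := hBD.apply (y v)
      rw [hx, col_apply, col_apply, ← mkOut_add] at this
      have := mkOut_injective this
      exact ⟨fun j => congrFun this.1 j, this.2⟩
  -- Energy balance for the colligation run through `𝐔*`, from the level-`N` states back to `x_∅`.
  have hnorm : ∀ N, ∑ n ∈ Finset.range N, levelSum n (fun v => ‖f v‖ ^ 2) + ‖x []‖ ^ 2
      = ∑ n ∈ Finset.range N, levelSum n (fun v => ‖g v‖ ^ 2)
        + levelSum N (fun v => ‖x v‖ ^ 2) := fun N => by
    induction N with
    | zero => simp [levelSum_zero]
    | succ N ih =>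
      have e : levelSum N (fun v => ‖x v‖ ^ 2) + levelSum N (fun v => ‖f v‖ ^ 2)
          = levelSum (N + 1) (fun v => ‖x v‖ ^ 2) + levelSum N (fun v => ‖g v‖ ^ 2) := by
        rw [levelSum_succ', ← levelSum_add, ← levelSum_add]
        congr 1
        ext v
        rw [← norm_sq_mkOut, ← hx v]
        exact hBD.norm_sq_add_norm_sq (y v)
      rw [Finset.sum_range_succ, Finset.sum_range_succ]
      linarith
  have hmem : Memℓp f 2 := by
    -- One `‖g‖²` bounds the coefficients of `g`, the other the states at level `N`, via `‖𝒞‖ ≤ 1`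
    -- and the bound on left quotients.
    refine memℓp_two_iff.mpr (summable_of_sum_levelSum_le (c := 2 * ‖g‖ ^ 2)
      (fun _ => by positivity) fun N => ?_)
    have e1 := (levelSum_mono N hxle).trans (levelSum_norm_sq_leftQuotient_le g N)
    have e2 := sum_levelSum_norm_sq_le g N
    nlinarith [hnorm N, sq_nonneg ‖x []‖]
  have hx0 : x [] = 0 := by
    have e : leftQuotient g [] = g := Subtype.ext (funext fun u => by simp [leftQuotient])
    change Γ (leftQuotient g []) = 0
    rw [e]
    exact (hΓ g).unique hg
  have hstate : ∀ v, state A B f v = x v := fun v => by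
    induction v with
    | nil => exact hx0.symm
    | cons j v ih => rw [state, ih, (hy v).1]
  exact ⟨⟨f, hmem⟩, fun v => by
    change g v = adjoint X (state A B f v) + D (f v)
    rw [hstate, (hy v).2]⟩

end BeurlingLax

end FockBL

end

theorem theorem5p2 {d : ℕ}
    {E : Type u} [NormedAddCommGroup E] [InnerProductSpace ℂ E] [CompleteSpace E]
    {F : Type v} [NormedAddCommGroup F] [InnerProductSpace ℂ F] [CompleteSpace F]
    (Z : Fin d → E →L[ℂ] E) (X : F →L[ℂ] E) (hZX : FockBL.IsAdmissible Z X)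
    (A : Fin d → E →L[ℂ] E) (hA : ∀ j, A j = ContinuousLinearMap.adjoint (Z j))
    (C : E →L[ℂ] F) (hC : C = ContinuousLinearMap.adjoint X) :
    -- `𝒞_{𝐙,X}` is a bounded operator on the Fock space, and `𝓜_{𝐙,X}` is its kernel
    (∃ Γ : FockBL.Fock d F →L[ℂ] E, (∀ f, HasSum (FockBL.ctrlTerm Z X f) (Γ f)) ∧
      FockBL.interpSpace Z X = {f | Γ f = 0}) ∧
    -- `𝓜_{𝐙,X}` is invariant under the shifts `f(z) ↦ f(z) · z_j`
    (∀ (j : Fin d) (f g : FockBL.Fock d F), f ∈ FockBL.interpSpace Z X →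
      (∀ a, g a = FockBL.shiftCoeff j f a) → g ∈ FockBL.interpSpace Z X) ∧
    -- the Cholesky factorization problem is solvable
    (∃ (V : Type (max u v)) (_ : NormedAddCommGroup V) (_ : InnerProductSpace ℂ V)
      (_ : CompleteSpace V) (B : Fin d → V →L[ℂ] E) (D : V →L[ℂ] F),
      FockBL.DimEqRank V (FockBL.defect A C) ∧ FockBL.IsCholesky A C B D ∧
      Function.Injective (FockBL.col B D)) ∧
    -- every solution yields a Beurling-Lax representer
    (∀ (V : Type w) [NormedAddCommGroup V] [InnerProductSpace ℂ V] [CompleteSpace V]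
      (B : Fin d → V →L[ℂ] E) (D : V →L[ℂ] F),
      FockBL.DimEqRank V (FockBL.defect A C) → FockBL.IsCholesky A C B D →
      FockBL.colligation A B C D ∘L
          ContinuousLinearMap.adjoint (FockBL.colligation A B C D) = 1 ∧
      FockBL.IsSchur (FockBL.transfer A B C D) ∧
      (FiniteDimensional ℂ V ∨ Function.Injective (FockBL.col B D) →
        FockBL.IsInner (FockBL.transfer A B C D)) ∧
      FockBL.mulRange (FockBL.transfer A B C D) = FockBL.interpSpace Z X) := by

  obtain rfl : A = fun j => ContinuousLinearMap.adjoint (Z j) := funext hA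
  subst hC
  have hiso := hZX.adjoint_col_comp_col_self
  refine ⟨?_, fun j f g hf hg => FockBL.interpSpace_shift j hf hg, FockBL.exists_isCholesky hiso, ?_⟩
  · obtain ⟨Γ, hΓ, -⟩ := hZX.exists_control
    refine ⟨Γ, hΓ, Set.ext fun f => ⟨fun hf => (hΓ f).unique hf, fun hf => ?_⟩⟩
    have := hΓ f
    rwa [show Γ f = 0 from hf] at this
  · intro V _ _ _ B D hdim hBD
    refine ⟨hBD.coisometric, ?_, fun hV => ?_, Set.ext fun g => ⟨?_, fun hg => ?_⟩⟩
    -- Without injectivity `[B; D]` is only contractive, hence the cost `‖[B; D] u‖²`.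
    · exact FockBL.isSchur_transfer (fun u => ‖FockBL.col B D u‖ ^ 2)
        (fun u => pow_le_pow_left₀ (norm_nonneg _) (hBD.norm_col_le u) 2)
        (hBD.norm_sq_col_add_col hiso)
    · have hinj : Function.Injective (FockBL.col B D) :=
        hV.elim (fun _ => hBD.injective_of_finiteDimensional hdim) id
      refine FockBL.isInner_transfer hZX.stable fun x u => ?_
      rw [hBD.norm_sq_col_add_col hiso, hBD.norm_col_eq hiso hinj]
    · rintro ⟨f, hf⟩
      exact FockBL.mem_interpSpace_of_eq_output hZX hBD f g fun v => by
        rw [hf, FockBL.mulCoeff_transfer]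
    · obtain ⟨f, hf⟩ := FockBL.exists_input_of_mem_interpSpace hZX hBD hg
      exact ⟨f, fun v => by rw [hf, FockBL.mulCoeff_transfer]⟩
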